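/- Let $d\ge 1$, let $\Omega\subseteq\mathbb R^d$ be an open set of finite Lebesgue measure $\mu(\Omega)<\infty$, and let $p:\Omega\to(0,\infty)$ be measurable with $$1<p_-:=\operatorname*{ess\,inf}_{\Omega}p\le p_+:=\operatorname*{ess\,sup}_{\Omega}p<\infty .$$ Suppose that there is $x_0\in\Omega$ with $p(x_0)=p_-$ such that $p$ is locally log-Hölder continuous at $x_0$, i.e. for some $C_0>0$, $|p(x)-p(x_0)|\le C_0/(-\log|x-x_0|)$ for all $x\in\Omega$ with $0<|x-x_0|<1/2$. Let $L_{p(\cdot)}(\Omega)$ be the space of measurable $f:\Omega\to\mathbb C$ with $\int_\Omega|f(x)/\lambda|^{p(x)}\,dx<\infty$ for some $\lambda>0$, with $\|f\|_{p(\cdot)}=\inf\{\lambda>0:\int_\Omega |f(x)/\lambda|^{p(x)}dx\le 1\}$. Write $f^*(t)=\inf\{s>0:\mu(\{|f|>s\})\le t\}$ and let $\mathcal E(t)=\sup\{f^*(t):\|f\|_{p(\cdot)}\le 1\}$, $t>0$, be the growth envelope function of $L_{p(\cdot)}(\Omega)$. Then $L_{p(\cdot)}(\Omega)$ has the growth envelope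 $(t^{-1/p_-},p_-)$. That is: 1. $L_{p(\cdot)}(\Omega)$ is not continuously embedded into $L_\infty(\Omega)$. 2. There are $\varepsilon,A,B>0$ such that $A\,t^{-1/p_-}\le\mathcal E(t)\le B\,t^{-1/p_-}$ for all $0<t<\varepsilon$. 3. The additional index of $L_{p(\cdot)}(\Omega)$ is $p_-$: let $\varepsilon>0$ and let $\Phi:(0,\varepsilon)\to(0,\infty)$ be any non-increasing continuously differentiable function with $A\,\Phi\le\mathcal E\le B\,\Phi$ on $(0,\varepsilon)$ for some constants $A,B>0$ (for instance $\Phi(t)=t^{-1/p_-}$ with $\varepsilon$ as in 2, or $\Phi=\mathcal E$ if $\mathcal E$ is positive, finite and continuously differentiable on $(0,\varepsilon)$). Then the infimum of all $0<v\le\infty$ for which there is $c>0$ with $$\left(-\int_0^\varepsilon\left(\frac{f^*(t)}{\Phi(t)}\right)^v\frac{\Phi'(t)}{\Phi(t)}\,dt\right)^{1/v}\le c\,\|f\|_{p(\cdot)}\qquad\text{for all } f\in L_{p(\cdot)}(\Omega)$$ (for $v=\infty$ the left-hand side is $\sup_{0<t<\varepsilon}f^*(t)/\Phi(t)$) equals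 $p_-$. -/

import Mathlib

open MeasureTheory Set
open scoped ENNReal NNReal

noncomputable section

section Rearrangement

variable {α : Type*} [MeasurableSpace α]

/-- The distribution function `s ↦ μ {|f| > s}`. -/
def distributionFunction (μ : Measure α) (f : α → ℂ) (s : ℝ) : ℝ≥0∞ :=
  μ {x | s < ‖f x‖}

/-- The non-increasing rearrangement `f*(t) = inf {s > 0 : μ {|f| > s} ≤ t}`, with `inf ∅ = ∞`. -/
def rearrangement (μ : Measure α) (f : α → ℂ) (t : ℝ) : ℝ≥0∞ :=
  ⨅ (s : ℝ) (_ : 0 < s) (_ : distributionFunction μ f s ≤ ENNReal.ofReal t), ENNReal.ofReal s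

end Rearrangement

section GrowthEnvelope

/- A function space on `(α, μ)` is given by its set `X` of functions and its quasi-norm `N`. -/

variable {α : Type*} [MeasurableSpace α]

/-- The growth envelope function `t ↦ sup {f*(t) : f ∈ X, ‖f‖ ≤ 1}`. -/
def growthEnvelopeFunction (μ : Measure α) (X : Set (α → ℂ)) (N : (α → ℂ) → ℝ≥0∞) (t : ℝ) :
    ℝ≥0∞ :=
  ⨆ (f : α → ℂ) (_ : f ∈ X) (_ : N f ≤ 1), rearrangement μ f t

/-- `X` is continuously embedded into `L_∞`. -/
def EmbedsInLinfty (μ : Measure α) (X : Set (α → ℂ)) (N : (α → ℂ) → ℝ≥0∞) : Prop :=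
  ∃ c : ℝ≥0, ∀ f ∈ X, eLpNorm f ∞ μ ≤ c * N f

/-- `F ∼ g` on `(0, ε)`. -/
def EquivOn (ε : ℝ) (F : ℝ → ℝ≥0∞) (g : ℝ → ℝ) : Prop :=
  ∃ A B : ℝ, 0 < A ∧ 0 < B ∧ ∀ t ∈ Ioo (0 : ℝ) ε,
    ENNReal.ofReal (A * g t) ≤ F t ∧ F t ≤ ENNReal.ofReal (B * g t)

/-- `Φ` represents, on `(0, ε)`, the equivalence class of the growth envelope function of `X`:
it is positive, non-increasing, continuously differentiable and equivalent to it. -/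
structure IsEnvelopeRepresentative (μ : Measure α) (X : Set (α → ℂ)) (N : (α → ℂ) → ℝ≥0∞)
    (Φ : ℝ → ℝ) (ε : ℝ) : Prop where
  contDiffOn : ContDiffOn ℝ 1 Φ (Ioo 0 ε)
  pos : ∀ t ∈ Ioo (0 : ℝ) ε, 0 < Φ t
  antitoneOn : AntitoneOn Φ (Ioo 0 ε)
  equivOn : EquivOn ε (growthEnvelopeFunction μ X N) Φ

/-- The left-hand side of the inequality defining the additional index:
`(- ∫_0^ε (f*(t) / Φ(t))^v Φ'(t) / Φ(t) dt)^{1/v}`, and `sup_{0<t<ε} f*(t) / Φ(t)` for `v = ∞`. -/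
def envelopeFunctional (μ : Measure α) (Φ : ℝ → ℝ) (ε : ℝ) (v : ℝ≥0∞) (f : α → ℂ) : ℝ≥0∞ :=
  if v = ∞ then ⨆ t ∈ Ioo (0 : ℝ) ε, rearrangement μ f t / ENNReal.ofReal (Φ t)
  else (∫⁻ t in Ioo (0 : ℝ) ε, (rearrangement μ f t / ENNReal.ofReal (Φ t)) ^ v.toReal *
    ENNReal.ofReal (-deriv Φ t / Φ t)) ^ (1 / v.toReal)

/-- The additional index, computed with the representative `Φ` on `(0, ε)`: the infimum of the
`0 < v ≤ ∞` for which `envelopeFunctional` is bounded by `c ‖f‖` on `X`. -/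
def additionalIndex (μ : Measure α) (X : Set (α → ℂ)) (N : (α → ℂ) → ℝ≥0∞)
    (Φ : ℝ → ℝ) (ε : ℝ) : ℝ≥0∞ :=
  sInf {v : ℝ≥0∞ | 0 < v ∧ ∃ c : ℝ≥0, 0 < c ∧ ∀ f ∈ X, envelopeFunctional μ Φ ε v f ≤ c * N f}

/-- `X` has the growth envelope `(Φ, u)`. The growth envelope function is taken up to equivalence
near `0`; the additional index has to be `u` whichever representative (for instance `Φ`, or the
growth envelope function itself if it is continuously differentiable) is used to compute it. -/
structure HasGrowthEnvelope (μ : Measure α) (X : Set (α → ℂ)) (N : (α → ℂ) → ℝ≥0∞)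
    (Φ : ℝ → ℝ) (u : ℝ≥0∞) : Prop where
  not_embedsInLinfty : ¬ EmbedsInLinfty μ X N
  representative : ∃ ε : ℝ, 0 < ε ∧ IsEnvelopeRepresentative μ X N Φ ε
  index : ∀ (Ψ : ℝ → ℝ) (ε : ℝ), 0 < ε → IsEnvelopeRepresentative μ X N Ψ ε →
    additionalIndex μ X N Ψ ε = u

end GrowthEnvelope

section VariableLebesgue

variable {α : Type*} [MeasurableSpace α]

/-- `p₋`, the essential infimum of the exponent. -/
def exponentInf (μ : Measure α) (p : α → ℝ) : ℝ≥0∞ :=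
  essInf (fun x => ENNReal.ofReal (p x)) μ

/-- `p₊`, the essential supremum of the exponent. -/
def exponentSup (μ : Measure α) (p : α → ℝ) : ℝ≥0∞ :=
  essSup (fun x => ENNReal.ofReal (p x)) μ

/-- The modular `∫ |f(x)|^{p(x)} dμ(x)`. -/
def modular (μ : Measure α) (p : α → ℝ) (f : α → ℂ) : ℝ≥0∞ :=
  ∫⁻ x, ‖f x‖ₑ ^ p x ∂μ

/-- The functions of the variable Lebesgue space `L_{p(·)}`. -/
def variableLebesgue (μ : Measure α) (p : α → ℝ) : Set (α → ℂ) :=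
  {f | AEMeasurable f μ ∧ ∃ l : ℝ, 0 < l ∧ modular μ p (fun x => f x / (l : ℂ)) < ∞}

/-- The quasi-norm `‖f‖_{p(·)} = inf {λ > 0 : modular (f / λ) ≤ 1}`. -/
def variableLebesgueNorm (μ : Measure α) (p : α → ℝ) (f : α → ℂ) : ℝ≥0∞ :=
  ⨅ (l : ℝ) (_ : 0 < l) (_ : modular μ p (fun x => f x / (l : ℂ)) ≤ 1), ENNReal.ofReal l

/-- `p : Ω → (0, ∞)` is an exponent function (only the values of `p` on `Ω` matter):
it is measurable and `p₋ > 0`. -/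
structure IsExponentFunction {d : ℕ} (Ω : Set (EuclideanSpace ℝ (Fin d)))
    (p : EuclideanSpace ℝ (Fin d) → ℝ) : Prop where
  aemeasurable : AEMeasurable p (volume.restrict Ω)
  pos : ∀ x ∈ Ω, 0 < p x
  inf_pos : 0 < exponentInf (volume.restrict Ω) p

/-- `p` is locally log-Hölder continuous at the point `x₀`. At `x = x₀` the inequality reads
`0 ≤ 0`. -/
def LogHolderAt {d : ℕ} (Ω : Set (EuclideanSpace ℝ (Fin d)))
    (p : EuclideanSpace ℝ (Fin d) → ℝ) (x₀ : EuclideanSpace ℝ (Fin d)) : Prop :=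
  ∃ C₀ : ℝ, 0 < C₀ ∧ ∀ x ∈ Ω, ‖x - x₀‖ < 1 / 2 →
    |p x - p x₀| ≤ C₀ / (-Real.log ‖x - x₀‖)

end VariableLebesgue

end

/-!
Write `ρ = p₋ = p x₀` and `μ` for Lebesgue measure on `Ω`.

All upper bounds come from one embedding: since `μ` is finite and `ρ ≤ p` almost everywhere,
`|f|^ρ ≤ |f|^p + 1` gives `L_{p(·)} ⊆ L_ρ` (`lintegral_enorm_rpow_le_variableLebesgueNorm`).
Markov's inequality in `L_ρ` bounds the growth envelope function by a multiple of `t^{-1/ρ}`. For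
the index, let `Ψ` be an envelope representative. The `ρ`-th power of the functional is
`∫ (f*)^ρ dH` with `H = Ψ^{-ρ} / ρ`, and `H(t) ≤ C t`. The layer-cake formula therefore bounds it
by a multiple of `∫ |f|^ρ` (`envelopeFunctional_le_lintegral`), so the exponent `ρ` is admissible.

All lower bounds near `t = 0` come from the truncated powers `max(|x - x₀|, δ)^{-d/ρ}` on the ball
of radius `R = 2^n δ` about `x₀`. Log-Hölder continuity at `x₀` allows `p(x)` to be replaced by `ρ`
in their modular at the cost of a constant, and a dyadic decomposition of the ball shows that
the modular is at most `K (1 + n)` (`exists_modular_truncatedPower_le`). Their rearrangement is of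
order `t^{-1/ρ}` between the measures of the balls of radii `δ` and `R`.
* For `n = 0` they are multiples of indicator functions, and the envelope function is at least a
  multiple of `t^{-1/ρ}` for small `t`. For the remaining `t < μ(Ω)` a constant function does the
  same (`le_growthEnvelopeFunction`). In particular the envelope function is unbounded, which
  excludes an embedding into `L_∞`.
* For fixed `R` and `n → ∞`, the `v`-th power of the functional is at least a multiple of
  `∫ d(-log Ψ)` over the corresponding range of `t`, hence grows linearly in `n`, whereas the norm
  is at most `(K (1 + n))^{1/ρ}`. So no `v < ρ` is admissible (`not_envelopeFunctional_le_of_lt`).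
-/

/-! ### The non-increasing rearrangement -/

section Rearrangement

variable {α : Type*} [MeasurableSpace α] {μ : Measure α} {f : α → ℂ}

theorem rearrangement_le_ofReal {s t : ℝ} (hs : 0 < s)
    (h : distributionFunction μ f s ≤ ENNReal.ofReal t) :
    rearrangement μ f t ≤ ENNReal.ofReal s :=
  iInf_le_of_le s (iInf_le_of_le hs (iInf_le_of_le h le_rfl))

theorem ofReal_le_rearrangement {a t : ℝ}
    (h : ∀ s, 0 < s → s < a → ENNReal.ofReal t < distributionFunction μ f s) :
    ENNReal.ofReal a ≤ rearrangement μ f t := by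
  refine le_iInf fun s => le_iInf fun hs => le_iInf fun hst => ENNReal.ofReal_le_ofReal ?_
  by_contra! hsa
  exact absurd hst (h s hs hsa).not_ge

theorem rearrangement_antitone : Antitone (rearrangement μ f) := fun _ _ hst =>
  le_iInf fun _ => le_iInf fun hr => le_iInf fun h =>
    rearrangement_le_ofReal hr (h.trans (ENNReal.ofReal_le_ofReal hst))

theorem rearrangement_eq_zero {t : ℝ} (h : μ univ ≤ ENNReal.ofReal t) :
    rearrangement μ f t = 0 := by
  refine nonpos_iff_eq_zero.1 (le_of_forall_gt_imp_ge_of_dense fun c hc => ?_)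
  rcases eq_or_ne c ∞ with rfl | hc'
  · exact le_top
  · rw [← ENNReal.ofReal_toReal hc']
    exact rearrangement_le_ofReal (ENNReal.toReal_pos hc.ne' hc')
      ((measure_mono (subset_univ _)).trans h)

theorem rearrangement_le_mul_rearrangement_div {l t : ℝ} (hl : 0 < l) :
    rearrangement μ f t ≤ ENNReal.ofReal l * rearrangement μ (fun x => f x / (l : ℂ)) t := by
  have hl' : ENNReal.ofReal l ≠ 0 := by simpa using hl
  rw [mul_comm, ← ENNReal.div_le_iff_le_mul (Or.inl hl') (Or.inl ENNReal.ofReal_ne_top)]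
  refine le_iInf fun s => le_iInf fun hs => le_iInf fun h => ?_
  rw [ENNReal.div_le_iff_le_mul (Or.inl hl') (Or.inl ENNReal.ofReal_ne_top),
    ← ENNReal.ofReal_mul hs.le]
  refine rearrangement_le_ofReal (by positivity) (le_trans (le_of_eq ?_) h)
  simp only [distributionFunction, norm_div, Complex.norm_real, Real.norm_of_nonneg hl.le,
    lt_div_iff₀ hl]

/-- The weak-type estimate: `f*(t) ≤ ‖f‖_ρ t^{-1/ρ}`, by Markov's inequality. -/
theorem rearrangement_le_lintegral {ρ t : ℝ} (hρ : 0 < ρ) (ht : 0 < t) (hf : AEMeasurable f μ) :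
    rearrangement μ f t ≤
      (∫⁻ x, ‖f x‖ₑ ^ ρ ∂μ) ^ (1 / ρ) * ENNReal.ofReal (t ^ (-1 / ρ)) := by
  refine le_of_forall_gt_imp_ge_of_dense fun c hc => ?_
  rcases eq_or_ne c ∞ with rfl | hc'
  · exact le_top
  have hc0 : 0 < c := (zero_le).trans_lt hc
  rw [← ENNReal.ofReal_toReal hc']
  refine rearrangement_le_ofReal (ENNReal.toReal_pos hc0.ne' hc') ?_
  have hI : ∫⁻ x, ‖f x‖ₑ ^ ρ ∂μ ≤ c ^ ρ * ENNReal.ofReal t := by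
    have h := ENNReal.rpow_le_rpow hc.le hρ.le
    rw [ENNReal.mul_rpow_of_nonneg _ _ hρ.le, ← ENNReal.rpow_mul, one_div,
      inv_mul_cancel₀ hρ.ne', ENNReal.rpow_one, ENNReal.ofReal_rpow_of_nonneg (by positivity) hρ.le,
      ← Real.rpow_mul ht.le, div_mul_cancel₀ _ hρ.ne', Real.rpow_neg_one] at h
    calc ∫⁻ x, ‖f x‖ₑ ^ ρ ∂μ
        = (∫⁻ x, ‖f x‖ₑ ^ ρ ∂μ) * (ENNReal.ofReal t⁻¹ * ENNReal.ofReal t) := by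
          rw [← ENNReal.ofReal_mul (by positivity), inv_mul_cancel₀ ht.ne', ENNReal.ofReal_one,
            mul_one]
      _ ≤ c ^ ρ * ENNReal.ofReal t := by rw [← mul_assoc]; gcongr
  have hM : c ^ ρ * distributionFunction μ f c.toReal ≤ ∫⁻ x, ‖f x‖ₑ ^ ρ ∂μ := by
    refine le_trans ?_ (mul_meas_ge_le_lintegral₀ (hf.enorm.pow_const ρ) (c ^ ρ))
    refine mul_le_mul_right (measure_mono fun x (hx : c.toReal < ‖f x‖) => ?_) _
    refine ENNReal.rpow_le_rpow ?_ hρ.le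
    rw [← ofReal_norm, ← ENNReal.ofReal_toReal hc']
    exact ENNReal.ofReal_le_ofReal hx.le
  exact (ENNReal.mul_le_mul_iff_right (ENNReal.rpow_pos hc0 hc').ne'
    (ENNReal.rpow_ne_top_of_nonneg hρ.le hc')).1 (hM.trans hI)

/-- If a measure `ν` on the line gives mass at most `C a` to `(0, a)` for each `a`, then
`∫ (f*)^ρ dν ≤ C ∫ |f|^ρ dμ`: by the layer-cake formula, since `{f* > s}` is contained in
`(0, μ {|f| > s})`. -/
theorem lintegral_rearrangement_rpow_le {ρ : ℝ} (hρ : 0 < ρ) (hf : AEMeasurable f μ)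
    {ν : Measure ℝ} {C : ℝ≥0} (hC : 0 < C) (hν : ν (Iic 0) = 0)
    (hνC : ∀ a : ℝ, 0 < a → ν (Ioo 0 a) ≤ C * ENNReal.ofReal a) :
    ∫⁻ t, rearrangement μ f t ^ ρ ∂ν ≤ C * ∫⁻ x, ‖f x‖ₑ ^ ρ ∂μ := by
  rcases eq_or_ne (∫⁻ x, ‖f x‖ₑ ^ ρ ∂μ) ∞ with hI | hI
  · rw [hI, ENNReal.mul_top (by exact_mod_cast hC.ne')]; exact le_top
  have hpos : ∀ᵐ t ∂ν, 0 < t := by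
    rw [ae_iff]; simpa [not_lt, Iic] using hν
  have hfin : ∀ t, 0 < t → rearrangement μ f t ≠ ∞ := fun t ht =>
    ((rearrangement_le_lintegral hρ ht hf).trans_lt (ENNReal.mul_lt_top
      (ENNReal.rpow_lt_top_of_nonneg (by positivity) hI) ENNReal.ofReal_lt_top)).ne
  have hmeas : Measurable (rearrangement μ f) := rearrangement_antitone.measurable
  have h1 : ∫⁻ t, rearrangement μ f t ^ ρ ∂ν =
      ∫⁻ t, ENNReal.ofReal ((rearrangement μ f t).toReal ^ ρ) ∂ν := by
    refine lintegral_congr_ae ?_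
    filter_upwards [hpos] with t ht
    rw [← ENNReal.ofReal_rpow_of_nonneg ENNReal.toReal_nonneg hρ.le,
      ENNReal.ofReal_toReal (hfin t ht)]
  have h2 : ∫⁻ x, ‖f x‖ₑ ^ ρ ∂μ = ∫⁻ x, ENNReal.ofReal (‖f x‖ ^ ρ) ∂μ := by
    refine lintegral_congr fun x => ?_
    rw [← ENNReal.ofReal_rpow_of_nonneg (norm_nonneg _) hρ.le, ofReal_norm]
  rw [h1, h2, lintegral_rpow_eq_lintegral_meas_lt_mul ν (Filter.Eventually.of_forall fun _ =>
    ENNReal.toReal_nonneg) hmeas.ennreal_toReal.aemeasurable hρ,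
    lintegral_rpow_eq_lintegral_meas_lt_mul μ (Filter.Eventually.of_forall fun _ =>
    norm_nonneg _) hf.norm hρ, mul_left_comm, ← lintegral_const_mul' _ _ ENNReal.coe_ne_top]
  refine mul_le_mul_right (setLIntegral_mono' measurableSet_Ioi fun s (hs : 0 < s) => ?_) _
  rw [← mul_assoc]
  refine mul_le_mul_left ?_ _
  rcases eq_or_ne (μ {x | s < ‖f x‖}) ∞ with hD | hD
  · rw [hD, ENNReal.mul_top (by exact_mod_cast hC.ne')]; exact le_top
  rw [← ENNReal.ofReal_toReal hD]
  set a := (μ {x | s < ‖f x‖}).toReal with ha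
  have hsub : {t | s < (rearrangement μ f t).toReal} ⊆ Iic 0 ∪ Ioo 0 a := by
    intro t (ht : s < _)
    by_contra! hta
    simp only [mem_union, mem_Iic, mem_Ioo, not_or, not_and, not_lt, not_le] at hta
    refine ht.not_ge ?_
    refine ENNReal.toReal_le_of_le_ofReal hs.le (rearrangement_le_ofReal hs ?_)
    rw [distributionFunction, ← ENNReal.ofReal_toReal hD]
    exact ENNReal.ofReal_le_ofReal (hta.2 hta.1)
  refine (measure_mono hsub).trans ((measure_union_le _ _).trans ?_)
  rw [hν, zero_add]
  rcases (ENNReal.toReal_nonneg : 0 ≤ a).eq_or_lt with h0 | h0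
  · rw [ha, ← h0]; simp
  · exact hνC a h0

end Rearrangement

/-! ### Modular and norm of variable Lebesgue spaces -/

section Modular

variable {α : Type*} [MeasurableSpace α] {μ : Measure α} {p : α → ℝ} {ρ : ℝ}

theorem lintegral_enorm_rpow_le_modular_add (hρ : 0 ≤ ρ) (hp : ∀ᵐ x ∂μ, ρ ≤ p x) (f : α → ℂ) :
    ∫⁻ x, ‖f x‖ₑ ^ ρ ∂μ ≤ modular μ p f + μ univ := by
  calc ∫⁻ x, ‖f x‖ₑ ^ ρ ∂μ ≤ ∫⁻ x, (‖f x‖ₑ ^ p x + 1) ∂μ := by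
        refine lintegral_mono_ae ?_
        filter_upwards [hp] with x hx
        rcases le_total ‖f x‖ₑ 1 with h | h
        · exact (ENNReal.rpow_le_one h hρ).trans le_add_self
        · exact (ENNReal.rpow_le_rpow_of_exponent_le h hx).trans le_self_add
    _ = modular μ p f + μ univ := by
        rw [lintegral_add_right _ measurable_const, lintegral_one, modular]

theorem enorm_eq_mul_enorm_div {l : ℝ} (hl : 0 < l) (z : ℂ) :
    ‖z‖ₑ = ENNReal.ofReal l * ‖z / (l : ℂ)‖ₑ := by
  rw [← ofReal_norm, ← ofReal_norm, ← ENNReal.ofReal_mul hl.le, norm_div, Complex.norm_real,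
    Real.norm_of_nonneg hl.le, mul_div_cancel₀ _ hl.ne']

theorem le_mul_variableLebesgueNorm {f : α → ℂ} {a c : ℝ≥0∞} (hc : c ≠ 0) (hc' : c ≠ ∞)
    (h : ∀ l : ℝ, 0 < l → modular μ p (fun x => f x / (l : ℂ)) ≤ 1 → a ≤ c * ENNReal.ofReal l) :
    a ≤ c * variableLebesgueNorm μ p f := by
  rw [mul_comm, ← ENNReal.div_le_iff_le_mul (Or.inl hc) (Or.inl hc')]
  refine le_iInf fun l => le_iInf fun hl => le_iInf fun hm => ?_
  rw [ENNReal.div_le_iff_le_mul (Or.inl hc) (Or.inl hc'), mul_comm]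
  exact h l hl hm

/-- The embedding of `L_{p(·)}` into `L_ρ` for `ρ ≤ p₋` over a finite measure space. -/
theorem lintegral_enorm_rpow_le_variableLebesgueNorm [IsFiniteMeasure μ] (hρ : 0 < ρ)
    (hp : ∀ᵐ x ∂μ, ρ ≤ p x) (f : α → ℂ) :
    (∫⁻ x, ‖f x‖ₑ ^ ρ ∂μ) ^ (1 / ρ) ≤
      (1 + μ univ) ^ (1 / ρ) * variableLebesgueNorm μ p f := by
  have hfin : 1 + μ univ ≠ ∞ :=
    ENNReal.add_ne_top.2 ⟨ENNReal.one_ne_top, measure_ne_top μ univ⟩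
  refine le_mul_variableLebesgueNorm
    (ENNReal.rpow_pos (by positivity) hfin).ne'
    (ENNReal.rpow_ne_top_of_nonneg (by positivity) hfin) fun l hl hm => ?_
  have h : ∫⁻ x, ‖f x‖ₑ ^ ρ ∂μ ≤ (1 + μ univ) * ENNReal.ofReal l ^ ρ := by
    simp only [fun x => enorm_eq_mul_enorm_div hl (f x), ENNReal.mul_rpow_of_nonneg _ _ hρ.le]
    rw [lintegral_const_mul' _ _ (ENNReal.rpow_ne_top_of_nonneg hρ.le ENNReal.ofReal_ne_top),
      mul_comm]
    gcongr
    exact (lintegral_enorm_rpow_le_modular_add hρ.le hp _).trans (by gcongr)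
  refine (ENNReal.rpow_le_rpow h (by positivity)).trans_eq ?_
  rw [ENNReal.mul_rpow_of_nonneg _ _ (by positivity), ← ENNReal.rpow_mul, mul_one_div_cancel hρ.ne',
    ENNReal.rpow_one]

/-- Dividing by `l ≥ 1` divides the modular by at least `l ^ p₋`. -/
theorem modular_div_le_one (hp : ∀ᵐ x ∂μ, ρ ≤ p x) (hρ : 0 < ρ) {f : α → ℂ} {l : ℝ}
    (hl : 1 ≤ l) (h : modular μ p f ≤ ENNReal.ofReal (l ^ ρ)) :
    modular μ p (fun x => f x / (l : ℂ)) ≤ 1 := by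
  have hl0 : 0 < l := by linarith
  have hne : ENNReal.ofReal (l ^ ρ) ≠ 0 := by
    rw [Ne, ENNReal.ofReal_eq_zero, not_le]; positivity
  refine (ENNReal.mul_le_mul_iff_right hne ENNReal.ofReal_ne_top).1 ?_
  rw [mul_one, modular, ← lintegral_const_mul' _ _ ENNReal.ofReal_ne_top]
  refine le_trans (lintegral_mono_ae ?_) h
  filter_upwards [hp] with x hx
  rw [enorm_eq_mul_enorm_div hl0 (f x), ENNReal.mul_rpow_of_nonneg _ _ (hρ.le.trans hx),
    ← ENNReal.ofReal_rpow_of_pos hl0]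
  gcongr
  exact ENNReal.one_le_ofReal.2 hl

theorem variableLebesgueNorm_le_of_modular_le (hp : ∀ᵐ x ∂μ, ρ ≤ p x)
    (hρ : 0 < ρ) {f : α → ℂ} {l : ℝ} (hl : 1 ≤ l) (h : modular μ p f ≤ ENNReal.ofReal (l ^ ρ)) :
    variableLebesgueNorm μ p f ≤ ENNReal.ofReal l :=
  iInf_le_of_le l (iInf_le_of_le (by linarith)
    (iInf_le_of_le (modular_div_le_one hp hρ hl h) le_rfl))

theorem mem_variableLebesgue_of_modular_lt_top {f : α → ℂ} (hf : AEMeasurable f μ)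
    (h : modular μ p f < ∞) : f ∈ variableLebesgue μ p :=
  ⟨hf, 1, one_pos, by simpa using h⟩

theorem growthEnvelopeFunction_le [IsFiniteMeasure μ] (hρ : 0 < ρ) (hp : ∀ᵐ x ∂μ, ρ ≤ p x) :
    ∃ B : ℝ, 0 < B ∧ ∀ t, 0 < t →
      growthEnvelopeFunction μ (variableLebesgue μ p) (variableLebesgueNorm μ p) t ≤
        ENNReal.ofReal (B * t ^ (-1 / ρ)) := by
  have hfin : 1 + μ univ ≠ ∞ :=
    ENNReal.add_ne_top.2 ⟨ENNReal.one_ne_top, measure_ne_top μ univ⟩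
  have hfin' : (1 + μ univ) ^ (1 / ρ) ≠ ∞ := ENNReal.rpow_ne_top_of_nonneg (by positivity) hfin
  refine ⟨((1 + μ univ) ^ (1 / ρ)).toReal, ENNReal.toReal_pos
    (ENNReal.rpow_pos (by positivity) hfin).ne' hfin', fun t ht => ?_⟩
  refine iSup_le fun f => iSup_le fun hf => iSup_le fun hN => ?_
  refine (rearrangement_le_lintegral hρ ht hf.1).trans ?_
  rw [ENNReal.ofReal_mul ENNReal.toReal_nonneg, ENNReal.ofReal_toReal hfin']
  refine mul_le_mul_left ((lintegral_enorm_rpow_le_variableLebesgueNorm hρ hp f).trans ?_) _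
  calc _ ≤ (1 + μ univ) ^ (1 / ρ) * 1 := by gcongr
    _ = _ := mul_one _

theorem rearrangement_le_growthEnvelopeFunction {X : Set (α → ℂ)} {N : (α → ℂ) → ℝ≥0∞}
    {f : α → ℂ} (hf : f ∈ X) (hN : N f ≤ 1) (t : ℝ) :
    rearrangement μ f t ≤ growthEnvelopeFunction μ X N t :=
  le_iSup_of_le f (le_iSup_of_le hf (le_iSup_of_le hN le_rfl))

/-- Every function of controlled modular bounds the growth envelope function from below. -/
theorem rearrangement_le_mul_growthEnvelopeFunction (hp : ∀ᵐ x ∂μ, ρ ≤ p x) (hρ : 0 < ρ)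
    {f : α → ℂ} (hf : AEMeasurable f μ) {l : ℝ} (hl : 1 ≤ l)
    (h : modular μ p f ≤ ENNReal.ofReal (l ^ ρ)) (t : ℝ) :
    rearrangement μ f t ≤ ENNReal.ofReal l *
      growthEnvelopeFunction μ (variableLebesgue μ p) (variableLebesgueNorm μ p) t := by
  have hm := modular_div_le_one hp hρ hl h
  refine (rearrangement_le_mul_rearrangement_div (by linarith : 0 < l)).trans ?_
  gcongr
  refine rearrangement_le_growthEnvelopeFunction
    (mem_variableLebesgue_of_modular_lt_top (hf.div_const _) (hm.trans_lt ENNReal.one_lt_top)) ?_ t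
  exact iInf_le_of_le 1 (iInf_le_of_le one_pos (iInf_le_of_le (by simpa using hm) (by simp)))

theorem growthEnvelopeFunction_eq_zero {X : Set (α → ℂ)} {N : (α → ℂ) → ℝ≥0∞} {t : ℝ}
    (h : μ univ ≤ ENNReal.ofReal t) : growthEnvelopeFunction μ X N t = 0 := by
  simp [growthEnvelopeFunction, rearrangement_eq_zero h]

theorem rearrangement_le_eLpNorm_top (f : α → ℂ) (t : ℝ) :
    rearrangement μ f t ≤ eLpNorm f ∞ μ := by
  refine le_of_forall_gt_imp_ge_of_dense fun c hc => ?_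
  rcases eq_or_ne c ∞ with rfl | hc'
  · exact le_top
  have hc0 : 0 < c := (zero_le).trans_lt hc
  rw [← ENNReal.ofReal_toReal hc']
  refine rearrangement_le_ofReal (ENNReal.toReal_pos hc0.ne' hc') ?_
  refine le_of_eq_of_le (b := 0) ?_ zero_le
  have : ∀ᵐ x ∂μ, ¬ c.toReal < ‖f x‖ := by
    filter_upwards [ae_le_eLpNormEssSup (f := f) (μ := μ)] with x hx h
    rw [eLpNorm_exponent_top] at hc
    have h' := hx.trans hc.le
    rw [← ofReal_norm, ← ENNReal.ofReal_toReal hc',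
      ENNReal.ofReal_le_ofReal_iff ENNReal.toReal_nonneg] at h'
    exact h.not_ge h'
  rw [ae_iff] at this
  simpa [distributionFunction] using this

/-- A space embedded into `L_∞` has a bounded growth envelope function. -/
theorem EmbedsInLinfty.growthEnvelopeFunction_le {X : Set (α → ℂ)} {N : (α → ℂ) → ℝ≥0∞}
    (h : EmbedsInLinfty μ X N) : ∃ c : ℝ≥0, ∀ t, growthEnvelopeFunction μ X N t ≤ c := by
  obtain ⟨c, hc⟩ := h
  refine ⟨c, fun t => iSup_le fun f => iSup_le fun hf => iSup_le fun hN => ?_⟩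
  calc rearrangement μ f t ≤ eLpNorm f ∞ μ := rearrangement_le_eLpNorm_top f t
    _ ≤ c * N f := hc f hf
    _ ≤ c * 1 := by gcongr
    _ = c := mul_one _

end Modular

/-! ### Bounds for the functional of the additional index -/

section Functional

theorem deriv_nonneg_of_monotoneOn_Ioo {G : ℝ → ℝ} {a b t : ℝ} (hG : MonotoneOn G (Ioo a b))
    (ht : t ∈ Ioo a b) : 0 ≤ deriv G t := by
  rw [← derivWithin_of_isOpen isOpen_Ioo ht]
  exact hG.derivWithin_nonneg

theorem lintegral_Ioo_deriv_of_monotoneOn {G : ℝ → ℝ} {a b ε : ℝ} (ha : 0 < a) (hab : a ≤ b)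
    (hb : b < ε) (hG : ContDiffOn ℝ 1 G (Ioo 0 ε)) (hmono : MonotoneOn G (Ioo 0 ε)) :
    ∫⁻ t in Ioo a b, ENNReal.ofReal (deriv G t) = ENNReal.ofReal (G b - G a) := by
  have hsub : Icc a b ⊆ Ioo 0 ε := Icc_subset_Ioo ha hb
  have hcont : ContinuousOn (deriv G) (Icc a b) :=
    (hG.continuousOn_deriv_of_isOpen isOpen_Ioo le_rfl).mono hsub
  have hderiv : ∀ t ∈ Icc a b, HasDerivAt G (deriv G t) t := fun t ht =>
    ((hG.differentiableOn one_ne_zero).differentiableAt (isOpen_Ioo.mem_nhds (hsub ht))).hasDerivAt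
  rw [restrict_Ioo_eq_restrict_Ioc, ← ofReal_integral_eq_lintegral_ofReal
    ((hcont.integrableOn_Icc).mono_set Ioc_subset_Icc_self),
    ← intervalIntegral.integral_of_le hab,
    intervalIntegral.integral_eq_sub_of_hasDerivAt (by rwa [uIcc_of_le hab])
      (hcont.intervalIntegrable_of_Icc hab)]
  filter_upwards [ae_restrict_mem measurableSet_Ioc] with t ht
  exact deriv_nonneg_of_monotoneOn_Ioo hmono (hsub (Ioc_subset_Icc_self ht))

theorem lintegral_Ioo_deriv_le_of_le_mul {H : ℝ → ℝ} {a C ε : ℝ} (hC : 0 ≤ C)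
    (hH : ContDiffOn ℝ 1 H (Ioo 0 ε)) (hmono : MonotoneOn H (Ioo 0 ε))
    (hpos : ∀ t ∈ Ioo 0 ε, 0 ≤ H t) (hle : ∀ t ∈ Ioo 0 ε, H t ≤ C * t) :
    ∫⁻ t in Ioo 0 ε ∩ Ioo 0 a, ENNReal.ofReal (deriv H t) ≤ ENNReal.ofReal (C * a) := by
  rw [Ioo_inter_Ioo, max_self]
  set b := min ε a
  rcases le_or_gt b 0 with hb | hb
  · simp [Ioo_eq_empty hb.not_gt]
  -- Exhaust `(0, b)` by compactly contained intervals, where the fundamental theorem applies.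
  obtain ⟨u, hu, hu', hulim⟩ := exists_seq_strictAnti_tendsto' (half_pos hb)
  have hIoo : Ioo 0 b = ⋃ n, Ioo (u n) (b - u n) := by
    ext t
    simp only [mem_iUnion, mem_Ioo]
    constructor
    · rintro ⟨h0, h1⟩
      obtain ⟨n, hn⟩ := (hulim.eventually_lt_const
        (lt_min h0 (sub_pos.2 h1))).exists
      rw [lt_min_iff] at hn
      exact ⟨n, hn.1, by linarith [hn.2]⟩
    · rintro ⟨n, h0, h1⟩
      have := (hu' n).1
      constructor <;> linarith
  rw [hIoo, setLIntegral_iUnion_of_directed]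
  · refine iSup_le fun n => ?_
    have h0 := (hu' n).1
    have h1 := (hu' n).2
    have hbε : b ≤ ε := min_le_left _ _
    have hba : b ≤ a := min_le_right _ _
    rw [lintegral_Ioo_deriv_of_monotoneOn h0 (by linarith) (by linarith) hH hmono]
    refine ENNReal.ofReal_le_ofReal ?_
    have h2 := hpos (u n) ⟨h0, by linarith⟩
    have h3 := hle (b - u n) ⟨by linarith, by linarith⟩
    have h4 : C * (b - u n) ≤ C * a := by gcongr; linarith
    linarith
  · refine Monotone.directed_le fun m n hmn => Ioo_subset_Ioo (hu.antitone hmn) ?_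
    have := hu.antitone hmn
    linarith

variable {α : Type*} [MeasurableSpace α] {μ : Measure α} {f : α → ℂ} {Ψ : ℝ → ℝ} {ε : ℝ}

/-- If `Ψ(t) ≥ C^{-1/ρ} t^{-1/ρ}`, the functional with exponent `ρ` is bounded by the `L_ρ`-norm:
its `ρ`-th power is the integral of `(f*)^ρ` against the measure `dH` with `H = Ψ^{-ρ} / ρ`, and
`H(t) ≤ (C / ρ) t`. -/
theorem envelopeFunctional_le_lintegral {ρ C : ℝ} (hρ : 0 < ρ) (hC : 0 < C)
    (hf : AEMeasurable f μ) (hΨ : ContDiffOn ℝ 1 Ψ (Ioo 0 ε)) (hpos : ∀ t ∈ Ioo 0 ε, 0 < Ψ t)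
    (hanti : AntitoneOn Ψ (Ioo 0 ε)) (hle : ∀ t ∈ Ioo 0 ε, Ψ t ^ (-ρ) ≤ C * t) :
    envelopeFunctional μ Ψ ε (ENNReal.ofReal ρ) f ≤
      ENNReal.ofReal (C / ρ) ^ (1 / ρ) * (∫⁻ x, ‖f x‖ₑ ^ ρ ∂μ) ^ (1 / ρ) := by
  rw [envelopeFunctional, if_neg ENNReal.ofReal_ne_top, ENNReal.toReal_ofReal hρ.le,
    ← ENNReal.mul_rpow_of_nonneg _ _ (by positivity)]
  refine ENNReal.rpow_le_rpow ?_ (by positivity)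
  set H : ℝ → ℝ := fun t => ρ⁻¹ * Ψ t ^ (-ρ) with hHdef
  have hH : ContDiffOn ℝ 1 H (Ioo 0 ε) :=
    contDiffOn_const.mul (hΨ.rpow_const_of_ne fun t ht => (hpos t ht).ne')
  have hHmono : MonotoneOn H (Ioo 0 ε) := fun s hs t ht hst =>
    mul_le_mul_of_nonneg_left (Real.rpow_le_rpow_of_nonpos (hpos t ht) (hanti hs ht hst)
      (by linarith)) (by positivity)
  have hHderiv : ∀ t ∈ Ioo 0 ε, deriv H t = Ψ t ^ (-ρ) * (-deriv Ψ t / Ψ t) := by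
    intro t ht
    have hd : HasDerivAt Ψ (deriv Ψ t) t := ((hΨ.differentiableOn one_ne_zero).differentiableAt
      (isOpen_Ioo.mem_nhds ht)).hasDerivAt
    rw [((hd.rpow_const (p := -ρ) (Or.inl (hpos t ht).ne')).const_mul ρ⁻¹).deriv,
      Real.rpow_sub_one (hpos t ht).ne']
    field_simp
  set w : ℝ → ℝ≥0∞ := fun t => ENNReal.ofReal (deriv H t)
  have hw : Measurable w := (measurable_deriv H).ennreal_ofReal
  have hr : Measurable fun t => rearrangement μ f t ^ ρ :=
    rearrangement_antitone.measurable.pow_const ρ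
  set ν := (volume.restrict (Ioo 0 ε)).withDensity w
  have hν : ∫⁻ t in Ioo 0 ε, (rearrangement μ f t / ENNReal.ofReal (Ψ t)) ^ ρ *
      ENNReal.ofReal (-deriv Ψ t / Ψ t) = ∫⁻ t, rearrangement μ f t ^ ρ ∂ν := by
    rw [lintegral_withDensity_eq_lintegral_mul _ hw hr]
    refine setLIntegral_congr_fun measurableSet_Ioo fun t ht => ?_
    have hΨt := hpos t ht
    simp only [Pi.mul_apply, w]
    rw [hHderiv t ht, ENNReal.ofReal_mul (by positivity), ENNReal.div_rpow_of_nonneg _ _ hρ.le,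
      ENNReal.ofReal_rpow_of_pos hΨt, Real.rpow_neg hΨt.le,
      ENNReal.ofReal_inv_of_pos (by positivity), div_eq_mul_inv]
    ring
  rw [hν]
  refine lintegral_rearrangement_rpow_le hρ hf (C := Real.toNNReal (C / ρ)) (by simp; positivity)
    ?_ fun a ha => ?_
  · rw [withDensity_apply _ measurableSet_Iic, Measure.restrict_restrict measurableSet_Iic,
      (disjoint_left.2 fun t ht ht' => ht'.1.not_ge ht : Disjoint (Iic (0 : ℝ)) (Ioo 0 ε)).inter_eq]
    simp
  · rw [withDensity_apply _ measurableSet_Ioo, Measure.restrict_restrict measurableSet_Ioo,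
      inter_comm]
    refine (lintegral_Ioo_deriv_le_of_le_mul (C := C / ρ) (by positivity) hH hHmono
      (fun t ht => ?_) fun t ht => ?_).trans_eq ?_
    · have := hpos t ht
      positivity
    · have := hle t ht
      calc ρ⁻¹ * Ψ t ^ (-ρ) ≤ ρ⁻¹ * (C * t) := by gcongr
        _ = C / ρ * t := by ring
    · rw [ENNReal.ofReal_mul (by positivity)]; rfl

/-- If `f* ≥ κ Ψ` on `(a, b)`, the `v`-th power of the functional is at least the integral of
`κ ^ v` against `d(-log Ψ)` over `(a, b)`. -/
theorem ofReal_mul_log_sub_log_le_envelopeFunctional {v : ℝ≥0∞} (hv : 0 < v) (hv' : v ≠ ∞)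
    {κ a b : ℝ} (hκ : 0 ≤ κ) (ha : 0 < a) (hab : a ≤ b) (hb : b < ε)
    (hΨ : ContDiffOn ℝ 1 Ψ (Ioo 0 ε)) (hpos : ∀ t ∈ Ioo 0 ε, 0 < Ψ t)
    (hanti : AntitoneOn Ψ (Ioo 0 ε))
    (hf : ∀ t ∈ Ioo a b, ENNReal.ofReal (κ * Ψ t) ≤ rearrangement μ f t) :
    ENNReal.ofReal (κ ^ v.toReal * (Real.log (Ψ a) - Real.log (Ψ b))) ≤
      envelopeFunctional μ Ψ ε v f ^ v.toReal := by
  have hv0 : 0 < v.toReal := ENNReal.toReal_pos hv.ne' hv'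
  rw [envelopeFunctional, if_neg hv', ← ENNReal.rpow_mul, one_div_mul_cancel hv0.ne',
    ENNReal.rpow_one]
  set G : ℝ → ℝ := fun t => -Real.log (Ψ t)
  have hG : ContDiffOn ℝ 1 G (Ioo 0 ε) := (hΨ.log fun t ht => (hpos t ht).ne').neg
  have hGmono : MonotoneOn G (Ioo 0 ε) := fun s hs t ht hst =>
    neg_le_neg (Real.log_le_log (hpos t ht) (hanti hs ht hst))
  have hGderiv : ∀ t ∈ Ioo 0 ε, deriv G t = -deriv Ψ t / Ψ t := by
    intro t ht
    have hd : HasDerivAt Ψ (deriv Ψ t) t := ((hΨ.differentiableOn one_ne_zero).differentiableAt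
      (isOpen_Ioo.mem_nhds ht)).hasDerivAt
    exact (hd.log (hpos t ht).ne').neg.deriv.trans (neg_div _ _).symm
  have hsub : Ioo a b ⊆ Ioo 0 ε := Ioo_subset_Ioo ha.le hb.le
  calc ENNReal.ofReal (κ ^ v.toReal * (Real.log (Ψ a) - Real.log (Ψ b)))
      = ENNReal.ofReal κ ^ v.toReal * ∫⁻ t in Ioo a b, ENNReal.ofReal (deriv G t) := by
        rw [lintegral_Ioo_deriv_of_monotoneOn ha hab hb hG hGmono,
          ENNReal.ofReal_mul (by positivity), ENNReal.ofReal_rpow_of_nonneg hκ hv0.le]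
        congr 2
        simp only [G]; ring
    _ = ∫⁻ t in Ioo a b, ENNReal.ofReal κ ^ v.toReal * ENNReal.ofReal (deriv G t) :=
        (lintegral_const_mul' _ _ (ENNReal.rpow_ne_top_of_nonneg hv0.le ENNReal.ofReal_ne_top)).symm
    _ ≤ ∫⁻ t in Ioo a b, (rearrangement μ f t / ENNReal.ofReal (Ψ t)) ^ v.toReal *
          ENNReal.ofReal (-deriv Ψ t / Ψ t) := by
        refine setLIntegral_mono' measurableSet_Ioo fun t ht => ?_
        have hΨt := hpos t (hsub ht)
        rw [hGderiv t (hsub ht)]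
        gcongr
        rw [ENNReal.le_div_iff_mul_le (Or.inl (by simpa using hΨt))
          (Or.inl ENNReal.ofReal_ne_top), ← ENNReal.ofReal_mul hκ]
        exact hf t ht
    _ ≤ _ := lintegral_mono_set hsub

end Functional

/-! ### Truncated powers of the distance to the point of minimal exponent -/

section TruncatedPower

open Metric

variable {d : ℕ} {Ω : Set (EuclideanSpace ℝ (Fin d))} {p : EuclideanSpace ℝ (Fin d) → ℝ}
  {x₀ : EuclideanSpace ℝ (Fin d)}

/-- The function `|x - x₀|^{-d/ρ}` on the ball of radius `R` about `x₀`, kept constant on the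
smaller ball of radius `δ`, and extended by zero. For `δ = R` it is a multiple of an indicator
function. -/
noncomputable def truncatedPower (x₀ : EuclideanSpace ℝ (Fin d)) (ρ δ R : ℝ) :
    EuclideanSpace ℝ (Fin d) → ℂ :=
  (ball x₀ R).indicator fun x => ((max ‖x - x₀‖ δ ^ (-(d : ℝ) / ρ) : ℝ) : ℂ)

theorem measurable_truncatedPower (x₀ : EuclideanSpace ℝ (Fin d)) (ρ δ R : ℝ) :
    Measurable (truncatedPower x₀ ρ δ R) := by
  refine Measurable.indicator ?_ measurableSet_ball
  fun_prop

theorem volume_ball_eq (x₀ : EuclideanSpace ℝ (Fin d)) {r : ℝ} (hr : 0 < r) :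
    volume (ball x₀ r) = ENNReal.ofReal
      (volume.real (ball (0 : EuclideanSpace ℝ (Fin d)) 1) * r ^ d) := by
  rw [Measure.addHaar_ball_of_pos _ _ hr, finrank_euclideanSpace_fin, mul_comm,
    ENNReal.ofReal_mul measureReal_nonneg, ofReal_measureReal]

theorem volume_real_unitBall_pos :
    0 < volume.real (ball (0 : EuclideanSpace ℝ (Fin d)) 1) :=
  ENNReal.toReal_pos (measure_ball_pos _ _ one_pos).ne' measure_ball_lt_top.ne

theorem ofReal_rpow_le_rearrangement_truncatedPower {ρ δ r R t : ℝ} (hρ : 0 < ρ) (hδ : 0 < δ)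
    (hδr : δ ≤ r) (hrR : r ≤ R) (hR : ball x₀ R ⊆ Ω)
    (ht : t < volume.real (ball (0 : EuclideanSpace ℝ (Fin d)) 1) * r ^ d) :
    ENNReal.ofReal (r ^ (-(d : ℝ) / ρ)) ≤
      rearrangement (volume.restrict Ω) (truncatedPower x₀ ρ δ R) t := by
  have hr : 0 < r := hδ.trans_le hδr
  refine ofReal_le_rearrangement fun s hs hsr => ?_
  calc ENNReal.ofReal t
      < ENNReal.ofReal (volume.real (ball (0 : EuclideanSpace ℝ (Fin d)) 1) * r ^ d) :=
        (ENNReal.ofReal_lt_ofReal_iff (mul_pos volume_real_unitBall_pos (by positivity))).2 ht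
    _ = volume.restrict Ω (ball x₀ r) := by
        rw [Measure.restrict_eq_self _ ((ball_subset_ball hrR).trans hR), volume_ball_eq x₀ hr]
    _ ≤ distributionFunction (volume.restrict Ω) (truncatedPower x₀ ρ δ R) s := by
        refine measure_mono fun x hx => ?_
        have hx' : ‖x - x₀‖ < r := by rwa [← dist_eq_norm]
        have hm : 0 < max ‖x - x₀‖ δ := lt_max_of_lt_right hδ
        rw [mem_ofPred_eq, truncatedPower, indicator_of_mem (ball_subset_ball hrR hx),
          Complex.norm_real, Real.norm_of_nonneg (by positivity)]
        refine hsr.trans_le (Real.rpow_le_rpow_of_nonpos hm (max_le hx'.le hδr) ?_)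
        rw [neg_div, neg_nonpos]; positivity

/-- Splitting the ball of radius `2 ^ n * δ` dyadically, each annulus contributes a bounded
amount. -/
theorem lintegral_ball_inv_max_pow_le (x₀ : EuclideanSpace ℝ (Fin d)) {δ : ℝ} (hδ : 0 < δ)
    (n : ℕ) :
    ∫⁻ x in ball x₀ (2 ^ n * δ), ENNReal.ofReal (max ‖x - x₀‖ δ ^ d)⁻¹ ≤
      ENNReal.ofReal (volume.real (ball (0 : EuclideanSpace ℝ (Fin d)) 1) * 2 ^ d * (1 + n)) := by
  set ω := volume.real (ball (0 : EuclideanSpace ℝ (Fin d)) 1)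
  have hω : 0 < ω := volume_real_unitBall_pos
  induction n with
  | zero =>
    calc ∫⁻ x in ball x₀ (2 ^ 0 * δ), ENNReal.ofReal (max ‖x - x₀‖ δ ^ d)⁻¹
        ≤ ∫⁻ _ in ball x₀ (2 ^ 0 * δ), ENNReal.ofReal (δ ^ d)⁻¹ := by
          refine lintegral_mono fun x => ENNReal.ofReal_le_ofReal ?_
          gcongr
          exact le_max_right _ _
      _ = ENNReal.ofReal ω := by
          rw [setLIntegral_const, pow_zero, one_mul, volume_ball_eq x₀ hδ,
            ← ENNReal.ofReal_mul (by positivity)]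
          congr 1
          field_simp
          rfl
      _ ≤ _ := by
          refine ENNReal.ofReal_le_ofReal ?_
          have : (1 : ℝ) ≤ 2 ^ d := one_le_pow₀ (by norm_num)
          push_cast
          nlinarith
  | succ n ih =>
    have hsplit : ball x₀ (2 ^ (n + 1) * δ) ⊆
        ball x₀ (2 ^ n * δ) ∪ ball x₀ (2 ^ (n + 1) * δ) \ ball x₀ (2 ^ n * δ) := by
      rw [union_sdiff_self]; exact subset_union_right
    refine (lintegral_mono_set hsplit).trans ((lintegral_union_le _ _ _).trans ?_)
    have hann : ∫⁻ x in ball x₀ (2 ^ (n + 1) * δ) \ ball x₀ (2 ^ n * δ),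
        ENNReal.ofReal (max ‖x - x₀‖ δ ^ d)⁻¹ ≤ ENNReal.ofReal (ω * 2 ^ d) := by
      calc _ ≤ ∫⁻ _ in ball x₀ (2 ^ (n + 1) * δ) \ ball x₀ (2 ^ n * δ),
              ENNReal.ofReal ((2 ^ n * δ) ^ d)⁻¹ := by
            refine setLIntegral_mono' (measurableSet_ball.diff measurableSet_ball) fun x hx => ?_
            refine ENNReal.ofReal_le_ofReal ?_
            have h : 2 ^ n * δ ≤ ‖x - x₀‖ := by
              rw [← dist_eq_norm]; exact not_lt.1 hx.2
            gcongr
            exact le_max_of_le_left h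
        _ ≤ ENNReal.ofReal ((2 ^ n * δ) ^ d)⁻¹ * volume (ball x₀ (2 ^ (n + 1) * δ)) := by
            rw [setLIntegral_const]
            gcongr
            exact sdiff_subset
        _ = ENNReal.ofReal (ω * 2 ^ d) := by
            rw [volume_ball_eq x₀ (by positivity), ← ENNReal.ofReal_mul (by positivity), pow_succ,
              mul_right_comm _ 2 δ, mul_pow _ 2 d]
            congr 1
            have : (2 ^ n * δ) ^ d ≠ 0 := by positivity
            field_simp
            rfl
    calc _ ≤ ENNReal.ofReal (ω * 2 ^ d * (1 + n)) + ENNReal.ofReal (ω * 2 ^ d) :=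
          add_le_add ih hann
      _ = _ := by
          rw [← ENNReal.ofReal_add (by positivity) (by positivity)]
          congr 1
          push_cast
          ring

/-- The effect of the log-Hölder condition: at distance `m` from `x₀`, replacing the exponent
`q ≤ ρ + C / (-log m)` by `ρ` costs only a constant factor. -/
theorem rpow_neg_rpow_le_of_le_add_div_log {m ρ q C : ℝ} (hm : 0 < m) (hm1 : m < 1) (hρ : 0 < ρ)
    (hq : q ≤ ρ + C / (-Real.log m)) :
    (m ^ (-(d : ℝ) / ρ)) ^ q ≤ Real.exp (d * C / ρ) * (m ^ d)⁻¹ := by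
  have hL : 0 < -Real.log m := neg_pos.2 (Real.log_neg hm hm1)
  rw [← Real.rpow_natCast m d, ← Real.rpow_neg hm.le, ← Real.rpow_mul hm.le,
    Real.rpow_def_of_pos hm, Real.rpow_def_of_pos hm, ← Real.exp_add, Real.exp_le_exp]
  have h : d / ρ * (-Real.log m * q) ≤ d / ρ * (-Real.log m * ρ + C) := by
    gcongr
    calc -Real.log m * q ≤ -Real.log m * (ρ + C / (-Real.log m)) := by gcongr
      _ = _ := by rw [mul_add, mul_div_cancel₀ _ hL.ne']
  calc Real.log m * (-(d : ℝ) / ρ * q) = d / ρ * (-Real.log m * q) := by ring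
    _ ≤ _ := h
    _ = _ := by field_simp; ring

/-- The modular of a truncated power grows at most linearly in the number `n` of dyadic annuli
between the radii `δ` and `2 ^ n * δ`, uniformly in `δ`. -/
theorem exists_modular_truncatedPower_le (hΩ : IsOpen Ω) (hx₀ : x₀ ∈ Ω) (hpos : ∀ x ∈ Ω, 0 < p x)
    (hlog : LogHolderAt Ω p x₀) :
    ∃ R₀ K : ℝ, 0 < R₀ ∧ 1 ≤ K ∧ ball x₀ R₀ ⊆ Ω ∧ ∀ (δ : ℝ) (n : ℕ), 0 < δ → 2 ^ n * δ ≤ R₀ →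
      modular (volume.restrict Ω) p (truncatedPower x₀ (p x₀) δ (2 ^ n * δ)) ≤
        ENNReal.ofReal (K * (1 + n)) := by
  obtain ⟨C, hC, hlog⟩ := hlog
  obtain ⟨R₁, hR₁, hball⟩ := Metric.isOpen_iff.1 hΩ x₀ hx₀
  set ω := volume.real (ball (0 : EuclideanSpace ℝ (Fin d)) 1)
  have hω : 0 < ω := volume_real_unitBall_pos
  set K := Real.exp (d * C / p x₀) * (ω * 2 ^ d)
  have hρ := hpos x₀ hx₀
  refine ⟨min R₁ (1 / 2), max 1 K, lt_min hR₁ (by norm_num), le_max_left _ _,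
    (ball_subset_ball (min_le_left _ _)).trans hball, fun δ n hδ hn => ?_⟩
  set R := 2 ^ n * δ
  have hδR : δ ≤ R := le_mul_of_one_le_left hδ.le (one_le_pow₀ (by norm_num))
  have hR2 : R ≤ 1 / 2 := hn.trans (min_le_right _ _)
  calc modular (volume.restrict Ω) p (truncatedPower x₀ (p x₀) δ R)
      ≤ ∫⁻ x in Ω, (ball x₀ R).indicator (fun x => ENNReal.ofReal (Real.exp (d * C / p x₀)) *
          ENNReal.ofReal (max ‖x - x₀‖ δ ^ d)⁻¹) x := by
        refine setLIntegral_mono' hΩ.measurableSet fun x hx => ?_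
        by_cases hxR : x ∈ ball x₀ R
        · have hxR' : ‖x - x₀‖ < R := by rwa [← dist_eq_norm]
          have hm : 0 < max ‖x - x₀‖ δ := lt_max_of_lt_right hδ
          have hm2 : max ‖x - x₀‖ δ ≤ 1 / 2 := (max_le hxR'.le hδR).trans hR2
          have hlm : 0 < -Real.log (max ‖x - x₀‖ δ) :=
            neg_pos.2 (Real.log_neg hm (by linarith))
          have hq : p x ≤ p x₀ + C / (-Real.log (max ‖x - x₀‖ δ)) := by
            -- At `x = x₀` the log-Hölder bound reads `0 ≤ C / 0 = 0`, as `Real.log 0 = 0`, and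
            -- `C / (-log ‖x - x₀‖)` is not monotone there; the claim is immediate.
            rcases (norm_nonneg (x - x₀)).eq_or_lt with h0 | h0
            · rw [eq_comm, norm_eq_zero, sub_eq_zero] at h0
              rw [h0] at hlm ⊢
              have : 0 ≤ C / (-Real.log (max ‖x₀ - x₀‖ δ)) := by positivity
              linarith
            · have h1 := (abs_le.1 (hlog x hx (hxR'.trans_le hR2))).2
              have h2 : C / (-Real.log ‖x - x₀‖) ≤ C / (-Real.log (max ‖x - x₀‖ δ)) := by
                gcongr
                exact le_max_left _ _
              linarith
          rw [truncatedPower, indicator_of_mem hxR, indicator_of_mem hxR, ← ofReal_norm,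
            Complex.norm_real, Real.norm_of_nonneg (by positivity),
            ENNReal.ofReal_rpow_of_pos (by positivity), ← ENNReal.ofReal_mul (by positivity)]
          exact ENNReal.ofReal_le_ofReal
            (rpow_neg_rpow_le_of_le_add_div_log hm (by linarith) hρ hq)
        · rw [truncatedPower, indicator_of_notMem hxR, indicator_of_notMem hxR, enorm_zero,
            ENNReal.zero_rpow_of_pos (hpos x hx)]
    _ ≤ ∫⁻ x, (ball x₀ R).indicator (fun x => ENNReal.ofReal (Real.exp (d * C / p x₀)) *
          ENNReal.ofReal (max ‖x - x₀‖ δ ^ d)⁻¹) x := setLIntegral_le_lintegral _ _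
    _ = ENNReal.ofReal (Real.exp (d * C / p x₀)) *
          ∫⁻ x in ball x₀ R, ENNReal.ofReal (max ‖x - x₀‖ δ ^ d)⁻¹ := by
        rw [lintegral_indicator measurableSet_ball,
          lintegral_const_mul' _ _ ENNReal.ofReal_ne_top]
    _ ≤ ENNReal.ofReal (Real.exp (d * C / p x₀)) *
          ENNReal.ofReal (ω * 2 ^ d * (1 + n)) := by
        gcongr
        exact lintegral_ball_inv_max_pow_le x₀ hδ n
    _ = ENNReal.ofReal (K * (1 + n)) := by
        rw [← ENNReal.ofReal_mul (by positivity)]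
        congr 1
        simp only [K]; ring
    _ ≤ _ := by
        refine ENNReal.ofReal_le_ofReal ?_
        gcongr
        exact le_max_right _ _

end TruncatedPower

/-! ### The growth envelope -/

section Envelope

open Metric Filter

variable {d : ℕ} {Ω : Set (EuclideanSpace ℝ (Fin d))} {p : EuclideanSpace ℝ (Fin d) → ℝ}
  {x₀ : EuclideanSpace ℝ (Fin d)}

/-- The truncated power has rearrangement of order `t^{-1/ρ}` on the range of `t` that
corresponds to the radii between `δ` and `R`. The factor `1 / 2` provides the strict inequality
between `t` and the measure of the ball of radius `(2 t / ω)^{1/d}`, with `ω` the measure of the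
unit ball. -/
theorem ofReal_mul_rpow_le_rearrangement_truncatedPower (hd : d ≠ 0) {ρ δ R t : ℝ} (hρ : 0 < ρ)
    (hδ : 0 < δ) (hR : ball x₀ R ⊆ Ω)
    (h₁ : volume.real (ball (0 : EuclideanSpace ℝ (Fin d)) 1) * δ ^ d / 2 ≤ t)
    (h₂ : t ≤ volume.real (ball (0 : EuclideanSpace ℝ (Fin d)) 1) * R ^ d / 2) (hR₀ : 0 ≤ R) :
    ENNReal.ofReal ((2 / volume.real (ball (0 : EuclideanSpace ℝ (Fin d)) 1)) ^ (-1 / ρ) *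
      t ^ (-1 / ρ)) ≤ rearrangement (volume.restrict Ω) (truncatedPower x₀ ρ δ R) t := by
  set ω := volume.real (ball (0 : EuclideanSpace ℝ (Fin d)) 1)
  have hω : 0 < ω := volume_real_unitBall_pos
  have ht : 0 < t := lt_of_lt_of_le (by positivity) h₁
  set r := (2 / ω * t) ^ ((d : ℝ)⁻¹)
  have hr : 0 ≤ r := by positivity
  have hrd : r ^ d = 2 / ω * t := Real.rpow_inv_natCast_pow (by positivity) hd
  have hr_rpow : r ^ (-(d : ℝ) / ρ) = (2 / ω) ^ (-1 / ρ) * t ^ (-1 / ρ) := by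
    rw [← Real.mul_rpow (by positivity) ht.le, ← Real.rpow_mul (by positivity)]
    congr 1
    have : (d : ℝ) ≠ 0 := by exact_mod_cast hd
    field_simp
  rw [← hr_rpow]
  refine ofReal_rpow_le_rearrangement_truncatedPower hρ hδ ?_ ?_ hR ?_
  · refine (pow_le_pow_iff_left₀ hδ.le hr hd).1 ?_
    rw [hrd, div_mul_eq_mul_div, le_div_iff₀ hω]
    linarith
  · refine (pow_le_pow_iff_left₀ hr hR₀ hd).1 ?_
    rw [hrd, div_mul_eq_mul_div, div_le_iff₀ hω]
    linarith
  · rw [hrd, ← mul_assoc, mul_div_cancel₀ _ hω.ne']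
    linarith

/-- Near `t = 0` the lower bound comes from indicator functions of small balls about `x₀`, for the
other `t` from a constant function. -/
theorem le_growthEnvelopeFunction (hd : d ≠ 0) (hΩ : IsOpen Ω) (hΩfin : volume Ω < ∞)
    (hx₀ : x₀ ∈ Ω) (hpos : ∀ x ∈ Ω, 0 < p x) (hlog : LogHolderAt Ω p x₀)
    (hp : ∀ᵐ x ∂volume.restrict Ω, p x₀ ≤ p x) :
    ∃ A : ℝ, 0 < A ∧ ∀ t, 0 < t → ENNReal.ofReal t < volume Ω →
      ENNReal.ofReal (A * t ^ (-1 / p x₀)) ≤ growthEnvelopeFunction (volume.restrict Ω)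
        (variableLebesgue (volume.restrict Ω) p)
        (variableLebesgueNorm (volume.restrict Ω) p) t := by
  obtain ⟨R₀, K, hR₀, hK, hball, hmod⟩ := exists_modular_truncatedPower_le hΩ hx₀ hpos hlog
  have hρ := hpos x₀ hx₀
  set ρ := p x₀
  set ω := volume.real (ball (0 : EuclideanSpace ℝ (Fin d)) 1)
  have hω : 0 < ω := volume_real_unitBall_pos
  set t₀ := ω * R₀ ^ d / 2
  have ht₀ : 0 < t₀ := by positivity
  set l₁ := K ^ (1 / ρ)
  have hl₁ : 1 ≤ l₁ := Real.one_le_rpow hK (by positivity)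
  set M := (volume Ω).toReal
  set l₂ := max 1 M ^ (1 / ρ)
  have hl₂ : 1 ≤ l₂ := Real.one_le_rpow (le_max_left _ _) (by positivity)
  set A₁ := (2 / ω) ^ (-1 / ρ) / l₁
  set A₂ := t₀ ^ (1 / ρ) / l₂
  refine ⟨min A₁ A₂, lt_min (by positivity) (by positivity), fun t ht htΩ => ?_⟩
  rcases le_or_gt t t₀ with h | h
  · set r := (2 / ω * t) ^ ((d : ℝ)⁻¹)
    have hr : 0 < r := by positivity
    have hrd : r ^ d = 2 / ω * t := Real.rpow_inv_natCast_pow (by positivity) hd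
    have hrt : ω * r ^ d / 2 = t := by rw [hrd]; field_simp
    have hrR : r ≤ R₀ := by
      refine (pow_le_pow_iff_left₀ hr.le hR₀.le hd).1 ?_
      rw [hrd, div_mul_eq_mul_div, div_le_iff₀ hω]
      simp only [t₀] at h
      linarith
    have hm : modular (volume.restrict Ω) p (truncatedPower x₀ ρ r r) ≤
        ENNReal.ofReal (l₁ ^ ρ) := by
      have := hmod r 0 hr (by simpa using hrR)
      rw [← Real.rpow_mul (by linarith), one_div_mul_cancel hρ.ne', Real.rpow_one]
      simpa using this
    have h₁ := ofReal_mul_rpow_le_rearrangement_truncatedPower hd hρ hr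
      ((ball_subset_ball hrR).trans hball) hrt.le hrt.ge hr.le
    have h₂ := h₁.trans (rearrangement_le_mul_growthEnvelopeFunction hp hρ
      (measurable_truncatedPower x₀ ρ r r).aemeasurable hl₁ hm t)
    refine le_trans (ENNReal.ofReal_le_ofReal ?_)
      ((ENNReal.ofReal_div_of_pos (by positivity)).trans_le (ENNReal.div_le_of_le_mul' h₂))
    calc min A₁ A₂ * t ^ (-1 / ρ) ≤ A₁ * t ^ (-1 / ρ) := by gcongr; exact min_le_left _ _
      _ = _ := by simp only [A₁]; ring
  · have hm : modular (volume.restrict Ω) p (fun _ => 1) ≤ ENNReal.ofReal (l₂ ^ ρ) := by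
      rw [← Real.rpow_mul (by positivity), one_div_mul_cancel hρ.ne', Real.rpow_one]
      calc modular (volume.restrict Ω) p (fun _ => 1) = ENNReal.ofReal M := by
            simp [modular, M, ENNReal.ofReal_toReal hΩfin.ne]
        _ ≤ _ := ENNReal.ofReal_le_ofReal (le_max_right _ _)
    have h₁ : ENNReal.ofReal 1 ≤ rearrangement (volume.restrict Ω) (fun _ => 1) t := by
      refine ofReal_le_rearrangement fun s hs hs1 => ?_
      simpa [distributionFunction, hs1] using htΩ
    have h₂ := h₁.trans (rearrangement_le_mul_growthEnvelopeFunction hp hρ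
      aemeasurable_const hl₂ hm t)
    refine le_trans (ENNReal.ofReal_le_ofReal ?_)
      ((ENNReal.ofReal_div_of_pos (by positivity)).trans_le (ENNReal.div_le_of_le_mul' h₂))
    calc min A₁ A₂ * t ^ (-1 / ρ) ≤ A₂ * t₀ ^ (-1 / ρ) := by
          refine mul_le_mul (min_le_right _ _) ?_ (by positivity) (by positivity)
          refine Real.rpow_le_rpow_of_nonpos ht₀ h.le ?_
          rw [neg_div, neg_nonpos]; positivity
      _ = 1 / l₂ := by
          simp only [A₂]
          rw [div_mul_eq_mul_div, ← Real.rpow_add ht₀, ← add_div, add_neg_cancel, zero_div,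
            Real.rpow_zero]

end Envelope

/-! ### The additional index -/

section Index

open Metric Filter

/-- An envelope representative inherits the order `t^{-1/ρ}` of the growth envelope function on
its whole interval; this interval lies in `(0, μ univ)` because the growth envelope function
vanishes beyond. -/
theorem IsEnvelopeRepresentative.exists_bounds {α : Type*} [MeasurableSpace α] {μ : Measure α}
    {X : Set (α → ℂ)} {N : (α → ℂ) → ℝ≥0∞} {Ψ : ℝ → ℝ} {ε ρ A B : ℝ}
    (h : IsEnvelopeRepresentative μ X N Ψ ε) (hA : 0 < A) (hB : 0 < B)
    (hlow : ∀ t, 0 < t → ENNReal.ofReal t < μ univ →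
      ENNReal.ofReal (A * t ^ (-1 / ρ)) ≤ growthEnvelopeFunction μ X N t)
    (hup : ∀ t, 0 < t → growthEnvelopeFunction μ X N t ≤ ENNReal.ofReal (B * t ^ (-1 / ρ))) :
    ∃ a b : ℝ, 0 < a ∧ 0 < b ∧ ∀ t ∈ Ioo 0 ε,
      a * t ^ (-1 / ρ) ≤ Ψ t ∧ Ψ t ≤ b * t ^ (-1 / ρ) := by
  obtain ⟨A', B', hA', hB', hE⟩ := h.equivOn
  refine ⟨A / B', B / A', by positivity, by positivity, fun t ht => ?_⟩
  have hΨ := h.pos t ht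
  have ht0 : 0 < t := ht.1
  obtain ⟨h₁, h₂⟩ := hE t ht
  have htμ : ENNReal.ofReal t < μ univ := by
    by_contra! hle
    rw [growthEnvelopeFunction_eq_zero hle, nonpos_iff_eq_zero, ENNReal.ofReal_eq_zero] at h₁
    exact h₁.not_gt (by positivity)
  constructor
  · have := (ENNReal.ofReal_le_ofReal_iff (by positivity)).1 ((hlow t ht0 htμ).trans h₂)
    rwa [div_mul_eq_mul_div, div_le_iff₀ hB', mul_comm (Ψ t)]
  · have := (ENNReal.ofReal_le_ofReal_iff (by positivity)).1 (h₁.trans (hup t ht0))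
    rwa [div_mul_eq_mul_div, le_div_iff₀ hA', mul_comm (Ψ t)]

theorem not_forall_natCast_linear_le_rpow {D D₁ M θ : ℝ} (hD₁ : 0 < D₁) (hθ : θ < 1) :
    ¬ ∀ n : ℕ, D + D₁ * n ≤ M * (1 + n) ^ θ := by
  intro h
  have h1 : Tendsto (fun n : ℕ => (1 + n : ℝ)) atTop atTop :=
    tendsto_atTop_add_const_left _ _ tendsto_natCast_atTop_atTop
  have h2 : Tendsto (fun n : ℕ => M * (1 + n : ℝ) ^ (-(1 - θ)) - (D - D₁) * (1 + n : ℝ)⁻¹)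
      atTop (nhds (M * 0 - (D - D₁) * 0)) :=
    (((tendsto_rpow_neg_atTop (sub_pos.2 hθ)).comp h1).const_mul M).sub
      ((tendsto_inv_atTop_zero.comp h1).const_mul _)
  have h3 : D₁ ≤ M * 0 - (D - D₁) * 0 := by
    refine ge_of_tendsto' h2 fun n => ?_
    have hn : (0 : ℝ) < 1 + n := by positivity
    have := h n
    rw [neg_sub, Real.rpow_sub_one hn.ne']
    have h4 : M * ((1 + n : ℝ) ^ θ / (1 + n)) - (D - D₁) * (1 + n : ℝ)⁻¹ =
        (M * (1 + n : ℝ) ^ θ - (D - D₁)) / (1 + n) := by field_simp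
    rw [h4, le_div_iff₀ hn]
    linarith
  linarith

variable {d : ℕ} {Ω : Set (EuclideanSpace ℝ (Fin d))} {p : EuclideanSpace ℝ (Fin d) → ℝ}
  {x₀ : EuclideanSpace ℝ (Fin d)}

/-- For `v < ρ`, testing on the truncated powers with `R` fixed and `δ = 2^{-n} R` shows that the
functional is not bounded: its `v`-th power grows at least linearly in `n`, while the `v`-th power
of the norm is of order at most `n ^ (v / ρ)`. -/
theorem not_envelopeFunctional_le_of_lt (hd : d ≠ 0) (hΩ : IsOpen Ω)
    (hx₀ : x₀ ∈ Ω) (hpos : ∀ x ∈ Ω, 0 < p x) (hlog : LogHolderAt Ω p x₀)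
    (hp : ∀ᵐ x ∂volume.restrict Ω, p x₀ ≤ p x) {Ψ : ℝ → ℝ} {ε a b : ℝ} (hε : 0 < ε)
    (hΨ : ContDiffOn ℝ 1 Ψ (Ioo 0 ε)) (hΨpos : ∀ t ∈ Ioo 0 ε, 0 < Ψ t)
    (hanti : AntitoneOn Ψ (Ioo 0 ε)) (ha : 0 < a) (hb : 0 < b)
    (hab : ∀ t ∈ Ioo 0 ε, a * t ^ (-1 / p x₀) ≤ Ψ t ∧ Ψ t ≤ b * t ^ (-1 / p x₀))
    {v : ℝ≥0∞} (hv : 0 < v) (hvρ : v < ENNReal.ofReal (p x₀)) (c : ℝ≥0) :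
    ¬ ∀ f ∈ variableLebesgue (volume.restrict Ω) p,
      envelopeFunctional (volume.restrict Ω) Ψ ε v f ≤
        c * variableLebesgueNorm (volume.restrict Ω) p f := by
  intro h
  obtain ⟨R₀, K, hR₀, hK, hball, hmod⟩ := exists_modular_truncatedPower_le hΩ hx₀ hpos hlog
  have hρ := hpos x₀ hx₀
  set ρ := p x₀
  set ω := volume.real (ball (0 : EuclideanSpace ℝ (Fin d)) 1)
  have hω : 0 < ω := volume_real_unitBall_pos
  have hv' : v ≠ ∞ := hvρ.ne_top
  set w := v.toReal
  have hw : 0 < w := ENNReal.toReal_pos hv.ne' hv'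
  have hwρ : w < ρ := by
    rw [← ENNReal.ofReal_toReal hv', ENNReal.ofReal_lt_ofReal_iff hρ] at hvρ
    exact hvρ
  -- A radius `R` for which the measure of the ball does not exceed `ε`.
  obtain ⟨R, hR, hRR₀, hRε⟩ : ∃ R : ℝ, 0 < R ∧ R ≤ R₀ ∧ ω * R ^ d ≤ ε := by
    refine ⟨min R₀ ((ε / ω) ^ ((d : ℝ)⁻¹)), lt_min hR₀ (by positivity), min_le_left _ _, ?_⟩
    calc ω * min R₀ ((ε / ω) ^ ((d : ℝ)⁻¹)) ^ d ≤ ω * ((ε / ω) ^ ((d : ℝ)⁻¹)) ^ d := by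
          gcongr
          exact min_le_right _ _
      _ = ε := by
          rw [Real.rpow_inv_natCast_pow (by positivity) hd, mul_div_cancel₀ _ hω.ne']
  set t₁ := ω * R ^ d / 2
  have ht₁ : 0 < t₁ := by positivity
  have ht₁ε : t₁ < ε := by
    have : 0 < ω * R ^ d := by positivity
    simp only [t₁]; linarith
  set κ := (2 / ω) ^ (-1 / ρ) / b
  have hκ : 0 < κ := by positivity
  refine not_forall_natCast_linear_le_rpow (D := κ ^ w * (Real.log a - Real.log t₁ / ρ -
    Real.log (Ψ t₁))) (D₁ := κ ^ w * (d * Real.log 2 / ρ)) (M := c ^ w * K ^ (w / ρ))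
    (θ := w / ρ) ?_ ((div_lt_one hρ).2 hwρ) fun n => ?_
  · have : 0 < d := Nat.pos_of_ne_zero hd
    positivity
  set δ := R / 2 ^ n
  have hδ : 0 < δ := by positivity
  have hδR : 2 ^ n * δ = R := mul_div_cancel₀ _ (by positivity)
  set f := truncatedPower x₀ ρ δ R
  set tn := ω * δ ^ d / 2
  have htn : 0 < tn := by positivity
  have htnlog : Real.log tn = Real.log t₁ - n * (d * Real.log 2) := by
    have : tn = t₁ / (2 ^ d) ^ n := by
      simp only [tn, t₁, δ, div_pow, ← pow_mul, mul_comm n d]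
      field_simp
    rw [this, Real.log_div ht₁.ne' (by positivity), Real.log_pow, Real.log_pow]
  have htnt₁ : tn ≤ t₁ := by
    have : δ ≤ R := div_le_self hR.le (one_le_pow₀ (by norm_num))
    simp only [tn, t₁]
    gcongr
  set l := (K * (1 + n)) ^ (1 / ρ)
  have hl : 1 ≤ l := by
    refine Real.one_le_rpow ?_ (by positivity)
    nlinarith [(Nat.cast_nonneg n : (0 : ℝ) ≤ n)]
  have hm : modular (volume.restrict Ω) p f ≤ ENNReal.ofReal (l ^ ρ) := by
    rw [← Real.rpow_mul (by positivity), one_div_mul_cancel hρ.ne', Real.rpow_one]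
    have := hmod δ n hδ (hδR.trans_le hRR₀)
    rwa [hδR] at this
  have hN := variableLebesgueNorm_le_of_modular_le hp hρ hl hm
  have hf : f ∈ variableLebesgue (volume.restrict Ω) p :=
    mem_variableLebesgue_of_modular_lt_top (measurable_truncatedPower x₀ ρ δ R).aemeasurable
      (hm.trans_lt ENNReal.ofReal_lt_top)
  have hup : envelopeFunctional (volume.restrict Ω) Ψ ε v f ^ w ≤
      ENNReal.ofReal (c ^ w * K ^ (w / ρ) * (1 + n) ^ (w / ρ)) := by
    calc envelopeFunctional (volume.restrict Ω) Ψ ε v f ^ w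
        ≤ (c * ENNReal.ofReal l) ^ w :=
          ENNReal.rpow_le_rpow ((h f hf).trans (by gcongr)) hw.le
      _ = ENNReal.ofReal ((c * l) ^ w) := by
          rw [← ENNReal.ofReal_rpow_of_nonneg (by positivity) hw.le,
            ENNReal.ofReal_mul c.coe_nonneg, ENNReal.ofReal_coe_nnreal]
      _ = _ := by
          rw [Real.mul_rpow c.coe_nonneg (by positivity), ← Real.rpow_mul (by positivity),
            Real.mul_rpow (by positivity) (by positivity), one_div_mul_eq_div, mul_assoc]
  have hlow := ofReal_mul_log_sub_log_le_envelopeFunctional (μ := volume.restrict Ω) (f := f)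
    hv hv' hκ.le htn htnt₁ ht₁ε hΨ hΨpos hanti fun t ht => by
      refine (ENNReal.ofReal_le_ofReal ?_).trans
        (ofReal_mul_rpow_le_rearrangement_truncatedPower hd hρ hδ
          ((ball_subset_ball hRR₀).trans hball) ht.1.le ht.2.le hR.le)
      calc κ * Ψ t ≤ κ * (b * t ^ (-1 / ρ)) := by
            gcongr
            exact (hab t ⟨htn.trans ht.1, ht.2.trans ht₁ε⟩).2
        _ = _ := by rw [← mul_assoc, div_mul_cancel₀ _ hb.ne']
  have hle := (ENNReal.ofReal_le_ofReal_iff (by positivity)).1 (hlow.trans hup)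
  refine le_trans ?_ hle
  have hlogΨ : Real.log a - Real.log tn / ρ ≤ Real.log (Ψ tn) := by
    have h₁ := (hab tn ⟨htn, htnt₁.trans_lt ht₁ε⟩).1
    have h₂ := Real.log_le_log (by positivity) h₁
    rw [Real.log_mul ha.ne' (by positivity), Real.log_rpow htn] at h₂
    linarith [show -1 / ρ * Real.log tn = -(Real.log tn / ρ) by ring]
  rw [mul_assoc, ← mul_add]
  gcongr
  rw [htnlog] at hlogΨ
  have : (Real.log t₁ - n * (d * Real.log 2)) / ρ = Real.log t₁ / ρ - d * Real.log 2 / ρ * n := by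
    ring
  linarith

end Index

theorem mainTheorem3 (d : ℕ) (hd : 1 ≤ d)
    (Ω : Set (EuclideanSpace ℝ (Fin d))) (hΩ : IsOpen Ω) (hΩfin : volume Ω < ∞)
    (p : EuclideanSpace ℝ (Fin d) → ℝ) (hp : IsExponentFunction Ω p)
    (hinf : 1 < exponentInf (volume.restrict Ω) p)
    (hsup : exponentSup (volume.restrict Ω) p < ∞)
    (x₀ : EuclideanSpace ℝ (Fin d)) (hx₀ : x₀ ∈ Ω)
    (hpx₀ : ENNReal.ofReal (p x₀) = exponentInf (volume.restrict Ω) p)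
    (hlog : LogHolderAt Ω p x₀) :
    HasGrowthEnvelope (volume.restrict Ω)
      (variableLebesgue (volume.restrict Ω) p)
      (variableLebesgueNorm (volume.restrict Ω) p)
      (fun t => t ^ (-1 / (exponentInf (volume.restrict Ω) p).toReal))
      (exponentInf (volume.restrict Ω) p) := by
  have hd' : d ≠ 0 := by omega
  have hpos := hp.pos
  have hρ : 0 < p x₀ := hpos x₀ hx₀
  have hinf_toReal : (exponentInf (volume.restrict Ω) p).toReal = p x₀ := by
    rw [← hpx₀, ENNReal.toReal_ofReal hρ.le]
  have hae : ∀ᵐ x ∂volume.restrict Ω, p x₀ ≤ p x := by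
    filter_upwards [ae_essInf_le (f := fun x => ENNReal.ofReal (p x)) (μ := volume.restrict Ω)]
      with x hx
    have h : ENNReal.ofReal (p x₀) ≤ ENNReal.ofReal (p x) := hpx₀.trans_le hx
    exact (ENNReal.ofReal_le_ofReal_iff' .. |>.1 h).resolve_right hρ.not_ge
  have : IsFiniteMeasure (volume.restrict Ω) := ⟨by simpa using hΩfin⟩
  obtain ⟨A, hA, hlow⟩ := le_growthEnvelopeFunction hd' hΩ hΩfin hx₀ hpos hlog hae
  obtain ⟨B, hB, hup⟩ := growthEnvelopeFunction_le hρ hae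
  have hexp : -1 / p x₀ < 0 := div_neg_of_neg_of_pos (by norm_num) hρ
  set M := (volume Ω).toReal
  have hM : 0 < M := ENNReal.toReal_pos (hΩ.measure_pos _ ⟨x₀, hx₀⟩).ne' hΩfin.ne
  have hltM : ∀ t, 0 < t → t < M → ENNReal.ofReal t < volume Ω := fun t ht₀ ht =>
    (ENNReal.ofReal_lt_iff_lt_toReal ht₀.le hΩfin.ne).2 ht
  rw [hinf_toReal, ← hpx₀]
  refine ⟨fun hemb => ?_, ⟨M, hM, ?_, ?_, ?_, ?_⟩, fun Ψ ε hε hΨ => ?_⟩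
  · obtain ⟨c, hc⟩ := hemb.growthEnvelopeFunction_le
    have htend : Filter.Tendsto (fun t : ℝ => A * t ^ (-1 / p x₀)) (nhdsWithin 0 (Ioi 0))
        Filter.atTop := (tendsto_rpow_neg_nhdsGT_zero hexp).const_mul_atTop hA
    obtain ⟨t, hct, ht0, htM⟩ := ((htend.eventually_gt_atTop (c : ℝ)).and
      (Ioo_mem_nhdsGT hM)).exists
    have h := (hlow t ht0 (hltM t ht0 htM)).trans (hc t)
    rw [← ENNReal.ofReal_coe_nnreal, ENNReal.ofReal_le_ofReal_iff c.coe_nonneg] at h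
    exact h.not_gt hct
  · exact fun t ht => (contDiffAt_id.rpow_const_of_ne ht.1.ne').contDiffWithinAt
  · exact fun t ht => Real.rpow_pos_of_pos ht.1 _
  · exact fun s hs t _ hst => Real.rpow_le_rpow_of_nonpos hs.1 hst hexp.le
  · exact ⟨A, B, hA, hB, fun t ht => ⟨hlow t ht.1 (hltM t ht.1 ht.2), hup t ht.1⟩⟩
  · obtain ⟨a, b, ha, hb, hab⟩ := hΨ.exists_bounds hA hB
      (fun t ht htμ => hlow t ht (by simpa using htμ)) hup
    refine le_antisymm (sInf_le ⟨by simpa using hρ, ?_⟩) (le_sInf fun v hv => ?_)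
    · set C := a ^ (-p x₀)
      have hC : 0 < C := Real.rpow_pos_of_pos ha _
      set c : ℝ≥0∞ := ENNReal.ofReal (C / p x₀) ^ (1 / p x₀) *
        (1 + volume.restrict Ω univ) ^ (1 / p x₀)
      have hfin : 1 + volume.restrict Ω univ ≠ ∞ :=
        ENNReal.add_ne_top.2 ⟨ENNReal.one_ne_top, measure_ne_top _ _⟩
      have hc : c ≠ ∞ := ENNReal.mul_ne_top
        (ENNReal.rpow_ne_top_of_nonneg (by positivity) ENNReal.ofReal_ne_top)
        (ENNReal.rpow_ne_top_of_nonneg (by positivity) hfin)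
      refine ⟨c.toNNReal + 1, by positivity, fun f hf => ?_⟩
      have hle : ∀ t ∈ Ioo 0 ε, Ψ t ^ (-p x₀) ≤ C * t := fun t ht => by
        have ht0 : 0 < t := ht.1
        calc Ψ t ^ (-p x₀) ≤ (a * t ^ (-1 / p x₀)) ^ (-p x₀) :=
              Real.rpow_le_rpow_of_nonpos (by positivity) (hab t ht).1 (by linarith)
          _ = C * t := by
              rw [Real.mul_rpow ha.le (by positivity), ← Real.rpow_mul ht0.le,
                div_mul_eq_mul_div, neg_one_mul, neg_neg, div_self hρ.ne', Real.rpow_one]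
      calc envelopeFunctional (volume.restrict Ω) Ψ ε (ENNReal.ofReal (p x₀)) f
          ≤ ENNReal.ofReal (C / p x₀) ^ (1 / p x₀) *
              (∫⁻ x in Ω, ‖f x‖ₑ ^ p x₀) ^ (1 / p x₀) :=
            envelopeFunctional_le_lintegral hρ hC hf.1 hΨ.contDiffOn hΨ.pos hΨ.antitoneOn hle
        _ ≤ c * variableLebesgueNorm (volume.restrict Ω) p f := by
            simp only [c]
            rw [mul_assoc]
            gcongr
            exact lintegral_enorm_rpow_le_variableLebesgueNorm hρ hae f
        _ ≤ _ := by
            gcongr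
            rw [ENNReal.coe_add, ENNReal.coe_toNNReal hc]
            exact le_self_add
    · obtain ⟨hv0, c, -, hc⟩ := hv
      by_contra! hlt
      exact not_envelopeFunctional_le_of_lt hd' hΩ hx₀ hpos hlog hae hε hΨ.contDiffOn hΨ.pos
        hΨ.antitoneOn ha hb hab hv0 hlt c hc
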